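/- Let $h:[0,\infty)\to\mathbb R$ be continuous on $[0,\infty)$ and three times differentiable on $(0,\infty)$, with $h(0)=0$, $h(t)\to\infty$ as $t\to\infty$, and $h'(t)>0$, $h''(t)<0$, $h'''(t)>0$ for all $t>0$; let $h^{-1}:[0,\infty)\to[0,\infty)$ be its inverse. For an interval $Q\subset\mathbb R$ and a locally integrable function $\varphi$ on $Q$ write $\langle\varphi\rangle_J=\frac1{|J|}\int_J\varphi$ and $$\|\varphi\|_{\mathrm{BMO}(Q)}=\sup_{J\subset Q}\langle|\varphi-\langle\varphi\rangle_J|^2\rangle_J^{1/2},\qquad K_{h,Q}(\varphi)=\sup_{J\subset Q}\langle h(|\varphi-\langle\varphi\rangle_J|)\rangle_J,$$ where the suprema are over all bounded subintervals $J$ of $Q$ of positive length; $\varphi\in\mathrm{BMO}(Q)$ means $\|\varphi\|_{\mathrm{BMO}(Q)}<\infty$. (i) Let $\varphi$ be locally integrable on $Q$, not almost everywhere equal to a constant, with $K_{h,Q}(\varphi)<\infty$. Then $\varphi\in\mathrm{BMO}(Q)$, $\|\varphi\|_{\mathrm{BMO}(Q)}>0$, and for every bounded subinterval $J$ of $Q$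 of positive length (all averages being finite) $$\frac{\langle\varphi^2\rangle_J-\langle\varphi\rangle_J^2}{4\|\varphi\|_{\mathrm{BMO}(Q)}^2}\,h\big(2\|\varphi\|_{\mathrm{BMO}(Q)}\big)\le\langle h(|\varphi-\langle\varphi\rangle_J|)\rangle_J .$$ Moreover, $$h^{-1}\big(K_{h,Q}(\varphi)\big)\le\|\varphi\|_{\mathrm{BMO}(Q)}\le\tfrac12\,h^{-1}\big(4K_{h,Q}(\varphi)\big).$$ (ii) The first inequality in (i) is sharp: let $J\subset Q$ be a subinterval with end points $a<b$ and let $t>0$. Let $\varphi$ be equal to $-2t$ on $[a,a+\frac{b-a}8]$, to $2t$ on $[b-\frac{b-a}8,b]$, and to $0$ elsewhere. Then $\varphi$ is locally integrable and not almost everywhere constant on $Q$, $K_{h,Q}(\varphi)<\infty$, $\|\varphi\|_{\mathrm{BMO}(Q)}=t$, and that inequality is an equality for this $\varphi$ and $J$. -/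

import Mathlib

open MeasureTheory Set Filter Topology
open scoped ENNReal

/-- The functions `h` under consideration: continuous on `[0,∞)`, three times differentiable on
`(0,∞)`, with `h(0) = 0`, `h(t) → ∞` as `t → ∞`, and `h' > 0`, `h'' < 0`, `h''' > 0` on `(0,∞)`. -/
structure IsProfile (h : ℝ → ℝ) : Prop where
  continuousOn : ContinuousOn h (Ici 0)
  map_zero : h 0 = 0
  tendsto_atTop : Tendsto h atTop atTop
  differentiable₁ : ∀ t, 0 < t → DifferentiableAt ℝ h t
  differentiable₂ : ∀ t, 0 < t → DifferentiableAt ℝ (deriv h) t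
  differentiable₃ : ∀ t, 0 < t → DifferentiableAt ℝ (deriv (deriv h)) t
  deriv_pos : ∀ t, 0 < t → 0 < deriv h t
  deriv₂_neg : ∀ t, 0 < t → deriv (deriv h) t < 0
  deriv₃_pos : ∀ t, 0 < t → 0 < deriv (deriv (deriv h)) t

/-- Such an `h` is a bijection of `[0,∞)` onto `[0,∞)`. -/
theorem IsProfile.bijOn {h : ℝ → ℝ} (hh : IsProfile h) : BijOn h (Ici 0) (Ici 0) := by
  have hmono : StrictMonoOn h (Ici 0) := by
    apply strictMonoOn_of_deriv_pos (convex_Ici 0) hh.continuousOn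
    intro x hx
    rw [interior_Ici] at hx
    exact hh.deriv_pos x hx
  refine ⟨?_, hmono.injOn, ?_⟩
  · intro x hx
    have := hmono.monotoneOn (mem_Ici.2 le_rfl) hx hx
    rwa [hh.map_zero] at this
  · intro y hy
    obtain ⟨b, hb, hb0⟩ :=
      ((hh.tendsto_atTop.eventually_ge_atTop y).and (eventually_ge_atTop 0)).exists
    obtain ⟨x, hx, rfl⟩ := intermediate_value_Icc hb0
      (hh.continuousOn.mono Icc_subset_Ici_self) ⟨by rw [hh.map_zero]; exact hy, hb⟩
    exact ⟨x, hx.1, rfl⟩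

/-- The inverse function of `h` on `[0,∞)` (for `h` as in `IsProfile`, see `IsProfile.bijOn`). -/
noncomputable def halfLineInv (h : ℝ → ℝ) : ℝ → ℝ := Function.invFunOn h (Ici 0)

/-- `K_{h,Q}(φ)`: the supremum over all bounded subintervals `J` of `Q` of the average over `J` of
`h(|φ - ⟨φ⟩_J|)`, as an element of `[0,∞]`. Adding end points to `J` changes none of the averages,
so `J` is represented by the open interval with the same end points. -/
noncomputable def KSup (h : ℝ → ℝ) (Q : Set ℝ) (φ : ℝ → ℝ) : ℝ≥0∞ :=
  ⨆ (a : ℝ) (b : ℝ) (_ : a < b) (_ : Ioo a b ⊆ Q),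
    ⨍⁻ x in Ioo a b, ENNReal.ofReal (h |φ x - ⨍ y in Ioo a b, φ y|) ∂volume

/-- The (quadratic) norm `‖φ‖_{BMO(Q)}`: the supremum over all bounded subintervals `J` of `Q` of
`⟨|φ - ⟨φ⟩_J|²⟩_J ^ (1/2)`, as an element of `[0,∞]`. -/
noncomputable def bmoNorm (Q : Set ℝ) (φ : ℝ → ℝ) : ℝ≥0∞ :=
  ⨆ (a : ℝ) (b : ℝ) (_ : a < b) (_ : Ioo a b ⊆ Q),
    (⨍⁻ x in Ioo a b, ENNReal.ofReal (|φ x - ⨍ y in Ioo a b, φ y| ^ 2) ∂volume) ^ (1 / 2 : ℝ)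

/-- `φ ∈ BMO(Q)`. -/
def MemBMO (Q : Set ℝ) (φ : ℝ → ℝ) : Prop :=
  LocallyIntegrableOn φ Q ∧ bmoNorm Q φ < ∞

/-- `φ` is (almost everywhere equal to) a constant on `Q`. -/
def IsConstantOn (Q : Set ℝ) (φ : ℝ → ℝ) : Prop :=
  ∃ c : ℝ, φ =ᵐ[volume.restrict Q] fun _ => c

/-- The step function equal to `-2t` on the first eighth of `[a,b]`, to `2t` on the last eighth of
`[a,b]`, and to `0` elsewhere. -/
noncomputable def stepFun (a b t : ℝ) (x : ℝ) : ℝ :=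
  if x ∈ Icc a (a + (b - a) / 8) then -2 * t
  else if x ∈ Icc (b - (b - a) / 8) b then 2 * t
  else 0

/-!
The heart of the matter is the sharp comparison of the quadratic with the linear mean oscillation:
if the quadratic oscillation of `f` is at most `ε` on every subinterval of `J`, and `f` has mean
zero on `J`, then `∫_J f² ≤ 2ε ∫_J |f|` (`integral_sq_le_two_mul_integral_abs`). By the rising sun
lemma (`exists_isOpen_mean_eq`) there is an open set `U` on whose components `f` has mean exactly
`ε`, and with `f ≤ ε` outside of `U`. On a component `I` the second moment is at most
`ε² + ε² = 2ε ⟨f⟩_I`, so `∫_U (f² - 2εf) ≤ 0`. There is a set `V` of the same kind for `-f`.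
Outside of both sets `|f| ≤ ε`, and therefore `f² - 2ε|f|` is dominated by
`1_U (f² - 2εf) + 1_V (f² + 2εf)`.

To pass to `h`, take the quadratic polynomial `α t² + β t` that agrees with `h` at `0` and to first
order at `s = 2ε`. It is a minorant of `h` because the third derivative of `h` is positive
(`IsProfile.quadratic_le`), and `β ≥ 0` because `h` is concave. Averaging it over `|φ - ⟨φ⟩_J|`, and
bounding the first moment from below by the variance divided by `s`, gives the lower estimate of the
`h`-oscillation (`IsProfile.mul_integral_sq_le`). Taking the supremum over `J` in it yields the
upper bound of the norm; the lower bound is Jensen's inequality.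

All this presupposes that `φ` has bounded mean oscillation. By Chebyshev's inequality, finiteness of
the `h`-oscillation means that `φ` is within a fixed distance `A` of a constant on each interval off
a set of relative measure at most `1/64`. This passes to the truncations of `φ`. For these the
largest oscillation `ε` is finite, and the comparison of the quadratic with the linear oscillation
bounds it by `9A` (`integral_sq_sub_average_le_of_weights`). Fatou's lemma then gives the claim for
`φ` (`integrableOn_sq_of_weights`).
-/

/-! ### Open sets of the line and the rising sun decomposition -/

/-- The components of a bounded open subset of the line are open intervals whose end points do not
belong to the set. -/
theorem IsOpen.connectedComponentIn_eq_Ioo {U : Set ℝ} (hU : IsOpen U) {a b x : ℝ}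
    (hab : U ⊆ Ioo a b) (hx : x ∈ U) :
    ∃ p q : ℝ, p < q ∧ p ∉ U ∧ q ∉ U ∧ connectedComponentIn U x = Ioo p q := by
  set C := connectedComponentIn U x with hC
  have hCU : C ⊆ U := connectedComponentIn_subset U x
  have hxC : x ∈ C := mem_connectedComponentIn hx
  have hCo : IsOpen C := hU.connectedComponentIn
  have hCc : IsConnected C := ⟨⟨x, hxC⟩, isPreconnected_connectedComponentIn⟩
  have hbb : BddBelow C := ⟨a, fun y hy => (hab (hCU hy)).1.le⟩
  have hba : BddAbove C := ⟨b, fun y hy => (hab (hCU hy)).2.le⟩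
  have hIoo := hCc.Ioo_csInf_csSup_subset hbb hba
  have hI : sInf C ∉ C := fun h => by
    obtain ⟨l, hl, hlC⟩ := exists_Ioc_subset_of_mem_nhds (hCo.mem_nhds h) ⟨_, sub_one_lt _⟩
    obtain ⟨z, hz1, hz2⟩ := exists_between hl
    exact (csInf_le hbb (hlC ⟨hz1, hz2.le⟩)).not_gt hz2
  have hS : sSup C ∉ C := fun h => by
    obtain ⟨l, hl, hlC⟩ := exists_Ico_subset_of_mem_nhds (hCo.mem_nhds h) ⟨_, lt_add_one _⟩
    obtain ⟨z, hz1, hz2⟩ := exists_between hl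
    exact (le_csSup hba (hlC ⟨hz1.le, hz2⟩)).not_gt hz1
  have hsub : C ⊆ Ioo (sInf C) (sSup C) := fun y hy =>
    ⟨(csInf_le hbb hy).lt_of_ne fun h => hI (h ▸ hy),
      (le_csSup hba hy).lt_of_ne fun h => hS (h ▸ hy)⟩
  have hx' := hsub hxC
  refine ⟨sInf C, sSup C, hx'.1.trans hx'.2, fun h => hI ?_, fun h => hS ?_, hsub.antisymm hIoo⟩
  · refine isPreconnected_Icc.subset_connectedComponentIn (s := Icc (sInf C) x)
      ⟨hx'.1.le, le_rfl⟩ (fun y hy => ?_) ⟨le_rfl, hx'.1.le⟩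
    rcases hy.1.eq_or_lt with rfl | hlt
    · exact h
    · exact hCU (hIoo ⟨hlt, hy.2.trans_lt hx'.2⟩)
  · refine isPreconnected_Icc.subset_connectedComponentIn (s := Icc x (sSup C))
      ⟨le_rfl, hx'.2.le⟩ (fun y hy => ?_) ⟨hx'.2.le, le_rfl⟩
    rcases hy.2.eq_or_lt with rfl | hlt
    · exact h
    · exact hCU (hIoo ⟨hx'.1.trans_le hy.1, hlt⟩)

theorem setIntegral_nonpos_of_components {U : Set ℝ} (hU : IsOpen U) {a b : ℝ}
    (hab : U ⊆ Ioo a b) {f : ℝ → ℝ} (hf : IntegrableOn f U)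
    (h : ∀ p q : ℝ, p < q → Ioo p q ⊆ U → p ∉ U → q ∉ U → ∫ x in Ioo p q, f x ≤ 0) :
    ∫ x in U, f x ≤ 0 := by
  set S : Set (Set ℝ) := connectedComponentIn U '' U with hS
  have hopen : ∀ C ∈ S, IsOpen C := by
    rintro _ ⟨x, _, rfl⟩
    exact hU.connectedComponentIn
  have hdisj : S.PairwiseDisjoint id := by
    rintro _ ⟨x, hx, rfl⟩ _ ⟨y, hy, rfl⟩ hne
    exact disjoint_left.2 fun z hzx hzy =>
      hne ((connectedComponentIn_eq hzx).trans (connectedComponentIn_eq hzy).symm)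
  have hcount : S.Countable := hdisj.countable_of_isOpen hopen (by
    rintro _ ⟨x, hx, rfl⟩
    exact ⟨x, mem_connectedComponentIn hx⟩)
  have hUnion : U = ⋃ C : S, (C : Set ℝ) := by
    ext x
    simp only [mem_iUnion, Subtype.exists, exists_prop]
    constructor
    · exact fun hx => ⟨_, ⟨x, hx, rfl⟩, mem_connectedComponentIn hx⟩
    · rintro ⟨_, ⟨y, _, rfl⟩, hx⟩
      exact connectedComponentIn_subset U y hx
  have := hcount.to_subtype
  have hsum : HasSum (fun C : S => ∫ x in (C : Set ℝ), f x) (∫ x in U, f x) := by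
    rw [hUnion] at hf ⊢
    refine hasSum_integral_iUnion (fun C => (hopen C C.2).measurableSet) (fun C D hne => ?_) hf
    exact hdisj C.2 D.2 fun h => hne (Subtype.ext h)
  refine hsum.nonpos ?_
  rintro ⟨_, x, hx, rfl⟩
  obtain ⟨p, q, hpq, hp, hq, hC⟩ := hU.connectedComponentIn_eq_Ioo hab hx
  simp only [hC]
  exact h p q hpq (hC ▸ connectedComponentIn_subset U x) hp hq

/-- The shadow of the rising sun for the graph of `G` over `(a, b)`: the points that see a higher
point of the graph to their right. Points higher than the left end point are added, so that the
component starting at `a`, if there is one, is balanced like all the others. -/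
def risingSun (G : ℝ → ℝ) (a b : ℝ) : Set ℝ :=
  {x | x ∈ Ioo a b ∧ (G a < G x ∨ ∃ y ∈ Ioc x b, G x < G y)}

theorem risingSun_subset (G : ℝ → ℝ) (a b : ℝ) : risingSun G a b ⊆ Ioo a b := fun _ hx => hx.1

theorem isOpen_risingSun {G : ℝ → ℝ} (hG : Continuous G) (a b : ℝ) :
    IsOpen (risingSun G a b) := by
  have : risingSun G a b = Ioo a b ∩ ({x | G a < G x} ∪
      ⋃ y ∈ Iic b, (Iio y ∩ {x | G x < G y})) := by
    ext x
    simp only [risingSun, mem_ofPred_eq, mem_inter_iff, mem_union, mem_iUnion, mem_Ioc, mem_Iic,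
      mem_Iio, exists_prop]
    refine and_congr_right fun _ => or_congr_right (exists_congr fun y => ?_)
    tauto
  rw [this]
  exact isOpen_Ioo.inter ((isOpen_lt continuous_const hG).union
    (isOpen_biUnion fun y _ => isOpen_Iio.inter (isOpen_lt hG continuous_const)))

/-- On a component of the shadow, `G` has equal values at the end points. -/
theorem risingSun_component {G : ℝ → ℝ} (hG : Continuous G) {a b p q : ℝ} (hGab : G b < G a)
    (hpq : p < q) (hsub : Ioo p q ⊆ risingSun G a b) (hp : p ∉ risingSun G a b)
    (hq : q ∉ risingSun G a b) : G p = G q := by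
  have hIcc : Icc p q ⊆ Icc a b := by
    rw [← closure_Ioo hpq.ne, ← closure_Ioo (a := a) (b := b)]
    · exact closure_mono (hsub.trans (risingSun_subset G a b))
    · rintro rfl
      exact lt_irrefl _ hGab
  have hap : a ≤ p := (hIcc ⟨le_rfl, hpq.le⟩).1
  have hqb : q ≤ b := (hIcc ⟨hpq.le, le_rfl⟩).2
  have hq' : ∀ y ∈ Ioc q b, G y ≤ G q := fun y hy => by
    by_contra! h
    exact hq ⟨⟨hap.trans_lt hpq, hy.1.trans_le hy.2⟩, Or.inr ⟨y, hy, h⟩⟩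
  have hGp : G p ≤ G a := by
    rcases hap.eq_or_lt with rfl | hlt
    · rfl
    · by_contra! h
      exact hp ⟨⟨hlt, hpq.trans_le hqb⟩, Or.inl h⟩
  have hGq : G q ≤ G a := by
    rcases hqb.eq_or_lt with rfl | hlt
    · exact hGab.le
    · by_contra! h
      exact hq ⟨⟨hap.trans_lt hpq, hlt⟩, Or.inl h⟩
  apply le_antisymm
  · by_contra! hlt
    -- the last point of `[p, q]` at an intermediate height cannot see anything higher
    obtain ⟨v, hv1, hv2⟩ := exists_between hlt
    obtain ⟨x, hx, hxv⟩ := intermediate_value_Icc' hpq.le hG.continuousOn ⟨hv1.le, hv2.le⟩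
    have hcomp : IsCompact (Icc p q ∩ {x | G x = v}) :=
      isCompact_Icc.inter_right (isClosed_eq hG continuous_const)
    obtain ⟨z, ⟨hzI, hzv⟩, hzmax⟩ := hcomp.exists_isGreatest ⟨x, hx, hxv⟩
    have hzv : G z = v := hzv
    have hpz : p < z := hzI.1.lt_of_ne (by rintro rfl; linarith)
    have hzq : z < q := hzI.2.lt_of_ne (by rintro rfl; linarith)
    obtain ⟨-, h | ⟨y, hy, hzy⟩⟩ := hsub ⟨hpz, hzq⟩
    · linarith
    · rcases le_or_gt y q with hyq | hyq
      · obtain ⟨w, hw, hwv⟩ := intermediate_value_Icc' hyq hG.continuousOn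
          (show v ∈ Icc (G q) (G y) from ⟨hv1.le, by linarith⟩)
        have := hzmax ⟨⟨hpz.le.trans (hy.1.le.trans hw.1), hw.2⟩, hwv⟩
        linarith [hw.1, hy.1]
      · linarith [hq' y ⟨hyq, hy.2⟩]
  · rcases hap.eq_or_lt with rfl | hlt
    · exact hGq
    · by_contra! h
      exact hp ⟨⟨hlt, hpq.trans_le hqb⟩, Or.inr ⟨q, ⟨hpq, hqb⟩, h⟩⟩

/-- The rising sun lemma: if `f` has mean less than `ε` on `(a, b)`, then there is an open set
all components of which carry the mean `ε`, and outside of which `f ≤ ε`. -/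
theorem exists_isOpen_mean_eq {f : ℝ → ℝ} {a b ε : ℝ} (hab : a < b)
    (hf : IntegrableOn f (Ioo a b)) (hmean : ∫ x in Ioo a b, f x < ε * (b - a)) :
    ∃ U : Set ℝ, IsOpen U ∧ U ⊆ Ioo a b ∧
      (∀ p q : ℝ, p < q → Ioo p q ⊆ U → p ∉ U → q ∉ U →
        ∫ x in Ioo p q, f x = ε * (q - p)) ∧
      ∀ᵐ x, x ∈ Ioo a b → x ∉ U → f x ≤ ε := by
  set g : ℝ → ℝ := (Ioo a b).indicator f with hg
  have hgi : Integrable g := (integrable_indicator_iff measurableSet_Ioo).2 hf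
  have hgii : ∀ c d : ℝ, IntervalIntegrable g volume c d := fun c d => hgi.intervalIntegrable
  set G : ℝ → ℝ := fun x => (∫ t in a..x, g t) - ε * (x - a) with hGdef
  have hGc : Continuous G := by
    have := intervalIntegral.continuous_primitive hgii a
    fun_prop
  have hGsub : ∀ p q : ℝ, a ≤ p → p ≤ q → q ≤ b →
      G q - G p = (∫ x in Ioo p q, f x) - ε * (q - p) := by
    intro p q hap hpq hqb
    have h1 : ∫ x in Ioo p q, f x = ∫ x in p..q, g x := by
      rw [intervalIntegral.integral_of_le hpq, integral_Ioc_eq_integral_Ioo]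
      exact setIntegral_congr_fun measurableSet_Ioo fun x hx =>
        (indicator_of_mem (show x ∈ Ioo a b from
          ⟨hap.trans_lt hx.1, hx.2.trans_le hqb⟩) f).symm
    rw [h1, ← intervalIntegral.integral_interval_sub_left (hgii a q) (hgii a p)]
    simp only [hGdef]
    ring
  have hGab : G b < G a := by
    have := hGsub a b le_rfl hab.le le_rfl
    linarith
  refine ⟨risingSun G a b, isOpen_risingSun hGc a b, risingSun_subset G a b, ?_, ?_⟩
  · intro p q hpq hsub hp hq
    have hIcc : Icc p q ⊆ Icc a b := by
      rw [← closure_Ioo hpq.ne, ← closure_Ioo hab.ne]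
      exact closure_mono (hsub.trans (risingSun_subset G a b))
    have := hGsub p q (hIcc ⟨le_rfl, hpq.le⟩).1 hpq.le (hIcc ⟨hpq.le, le_rfl⟩).2
    have := risingSun_component hGc hGab hpq hsub hp hq
    linarith
  · filter_upwards [_root_.LocallyIntegrable.ae_hasDerivAt_integral hgi.locallyIntegrable]
      with x hx hxab hxU
    have hd : HasDerivAt G (f x - ε) x := by
      have h1 := (hx a).sub (((hasDerivAt_id x).sub_const a).const_mul ε)
      rw [hg, indicator_of_mem hxab, mul_one] at h1
      exact h1
    have hle : ∀ y ∈ Ioc x b, G y ≤ G x := fun y hy => by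
      by_contra! h
      exact hxU ⟨hxab, Or.inr ⟨y, hy, h⟩⟩
    have hslope := (hasDerivWithinAt_iff_tendsto_slope' (s := Ioi x) (by simp)).1
      hd.hasDerivWithinAt
    have : f x - ε ≤ 0 := by
      refine le_of_tendsto hslope ?_
      filter_upwards [Ioc_mem_nhdsGT hxab.2] with y hy
      rw [slope_def_field]
      exact div_nonpos_of_nonpos_of_nonneg (by linarith [hle y hy]) (by linarith [hy.1])
    linarith

/-! ### Comparing the quadratic and the linear oscillation -/

theorem mul_setAverage_Ioo {a b : ℝ} (hab : a < b) (f : ℝ → ℝ) :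
    (b - a) * ⨍ x in Ioo a b, f x = ∫ x in Ioo a b, f x := by
  rw [setAverage_eq, Real.volume_real_Ioo_of_le hab.le, smul_eq_mul,
    mul_inv_cancel_left₀ (sub_ne_zero.2 hab.ne')]

theorem setAverage_Ioo_eq {a b : ℝ} (hab : a < b) (f : ℝ → ℝ) :
    ⨍ x in Ioo a b, f x = (∫ x in Ioo a b, f x) / (b - a) := by
  rw [← mul_setAverage_Ioo hab, mul_div_cancel_left₀ _ (sub_ne_zero.2 hab.ne')]

theorem setIntegral_Ioo_const {a b : ℝ} (hab : a ≤ b) (c : ℝ) :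
    ∫ _ in Ioo a b, c = c * (b - a) := by
  rw [setIntegral_const, Real.volume_real_Ioo_of_le hab, smul_eq_mul, mul_comm]

theorem integrableOn_Ioo_const {a b : ℝ} (c : ℝ) : IntegrableOn (fun _ => c) (Ioo a b) :=
  integrableOn_const (by simp)

theorem integrableOn_sq_sub_const {f : ℝ → ℝ} {a b : ℝ} (hf : IntegrableOn f (Ioo a b))
    (hf2 : IntegrableOn (fun x => f x ^ 2) (Ioo a b)) (c : ℝ) :
    IntegrableOn (fun x => (f x - c) ^ 2) (Ioo a b) := by
  refine ((hf2.sub (hf.const_mul (2 * c))).add (integrableOn_Ioo_const (c ^ 2))).congr_fun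
    (fun x _ => ?_) measurableSet_Ioo
  simp only [Pi.add_apply, Pi.sub_apply]
  ring

theorem integral_sq_sub_const {f : ℝ → ℝ} {a b : ℝ} (hab : a ≤ b) (hf : IntegrableOn f (Ioo a b))
    (hf2 : IntegrableOn (fun x => f x ^ 2) (Ioo a b)) (c : ℝ) :
    ∫ x in Ioo a b, (f x - c) ^ 2
      = (∫ x in Ioo a b, f x ^ 2) - 2 * c * (∫ x in Ioo a b, f x) + c ^ 2 * (b - a) := by
  have hi : IntegrableOn (fun x => f x ^ 2 - 2 * c * f x) (Ioo a b) := hf2.sub (hf.const_mul _)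
  rw [← setIntegral_Ioo_const hab (c ^ 2), ← integral_const_mul, ← integral_sub hf2
    (hf.const_mul _), ← integral_add hi (integrableOn_Ioo_const _)]
  exact integral_congr_ae (Eventually.of_forall fun x => by ring)

theorem integral_sq_sub_setAverage_le {f : ℝ → ℝ} {a b : ℝ} (hab : a < b)
    (hf : IntegrableOn f (Ioo a b)) (hf2 : IntegrableOn (fun x => f x ^ 2) (Ioo a b)) (c : ℝ) :
    ∫ x in Ioo a b, (f x - ⨍ y in Ioo a b, f y) ^ 2 ≤ ∫ x in Ioo a b, (f x - c) ^ 2 := by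
  rw [integral_sq_sub_const hab.le hf hf2, integral_sq_sub_const hab.le hf hf2,
    ← mul_setAverage_Ioo hab f]
  nlinarith [mul_nonneg (sub_nonneg.2 hab.le) (sq_nonneg ((⨍ y in Ioo a b, f y) - c))]

/-- Where the mean of `f` is exactly `ε`, the second moment is at most `2ε²`, which is `2ε` times
the mean. Hence the same comparison over the set given by the rising sun lemma. -/
theorem exists_isOpen_integral_sq_sub_nonpos {f : ℝ → ℝ} {a b ε : ℝ} (hab : a < b)
    (hf : IntegrableOn f (Ioo a b)) (hf2 : IntegrableOn (fun x => f x ^ 2) (Ioo a b))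
    (hosc : ∀ c d : ℝ, a ≤ c → c < d → d ≤ b →
      ∫ x in Ioo c d, (f x - ⨍ y in Ioo c d, f y) ^ 2 ≤ ε ^ 2 * (d - c))
    (hmean : ∫ x in Ioo a b, f x < ε * (b - a)) :
    ∃ U : Set ℝ, IsOpen U ∧ U ⊆ Ioo a b ∧ ∫ x in U, (f x ^ 2 - 2 * ε * f x) ≤ 0 ∧
      ∀ᵐ x, x ∈ Ioo a b → x ∉ U → f x ≤ ε := by
  obtain ⟨U, hU, hUab, hcomp, hle⟩ := exists_isOpen_mean_eq hab hf hmean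
  refine ⟨U, hU, hUab, ?_, hle⟩
  refine setIntegral_nonpos_of_components hU hUab
    ((hf2.sub (hf.const_mul (2 * ε))).mono_set hUab) fun p q hpq hsub hp hq => ?_
  have hIcc : Icc p q ⊆ Icc a b := by
    rw [← closure_Ioo hpq.ne, ← closure_Ioo hab.ne]
    exact closure_mono (hsub.trans hUab)
  have hfp := hf.mono_set (hsub.trans hUab)
  have hf2p := hf2.mono_set (hsub.trans hUab)
  have h1 := hosc p q (hIcc ⟨le_rfl, hpq.le⟩).1 hpq (hIcc ⟨hpq.le, le_rfl⟩).2
  have h2 := hcomp p q hpq hsub hp hq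
  have h3 : ⨍ y in Ioo p q, f y = ε := by
    rw [setAverage_Ioo_eq hpq, h2, mul_div_cancel_right₀ _ (sub_ne_zero.2 hpq.ne')]
  rw [h3, integral_sq_sub_const hpq.le hfp hf2p, h2] at h1
  rw [integral_sub hf2p (hfp.const_mul _), integral_const_mul, h2]
  linarith

theorem integral_sq_le_two_mul_integral_abs {f : ℝ → ℝ} {a b ε : ℝ} (hab : a < b) (hε : 0 < ε)
    (hf : IntegrableOn f (Ioo a b)) (hf2 : IntegrableOn (fun x => f x ^ 2) (Ioo a b))
    (hosc : ∀ c d : ℝ, a ≤ c → c < d → d ≤ b →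
      ∫ x in Ioo c d, (f x - ⨍ y in Ioo c d, f y) ^ 2 ≤ ε ^ 2 * (d - c))
    (h0 : ∫ x in Ioo a b, f x = 0) :
    ∫ x in Ioo a b, f x ^ 2 ≤ 2 * ε * ∫ x in Ioo a b, |f x| := by
  have hpos : 0 < ε * (b - a) := mul_pos hε (sub_pos.2 hab)
  obtain ⟨U, hU, hUab, hUint, hUle⟩ :=
    exists_isOpen_integral_sq_sub_nonpos hab hf hf2 hosc (h0 ▸ hpos)
  obtain ⟨V, hV, hVab, hVint, hVle⟩ :=
    exists_isOpen_integral_sq_sub_nonpos (f := fun x => -f x) hab hf.neg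
      (by simpa using hf2) (fun c d hac hcd hdb => by
        have := hosc c d hac hcd hdb
        rw [average_neg]
        refine le_of_eq_of_le (integral_congr_ae (Eventually.of_forall fun x => ?_)) this
        ring) (by rw [integral_neg, h0, neg_zero]; exact hpos)
  have hi1 : IntegrableOn (fun x => f x ^ 2 - 2 * ε * f x) (Ioo a b) := hf2.sub (hf.const_mul _)
  have hfn : IntegrableOn (fun x => -f x) (Ioo a b) := hf.neg
  have hfn2 : IntegrableOn (fun x => (-f x) ^ 2) (Ioo a b) := by simpa using hf2
  have hi2 : IntegrableOn (fun x => (-f x) ^ 2 - 2 * ε * -f x) (Ioo a b) :=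
    hfn2.sub (hfn.const_mul (2 * ε))
  have hi3 : IntegrableOn (fun x => f x ^ 2 - 2 * ε * |f x|) (Ioo a b) :=
    hf2.sub (hf.abs.const_mul _)
  have hU' : ∫ x in Ioo a b, U.indicator (fun x => f x ^ 2 - 2 * ε * f x) x ≤ 0 := by
    rwa [setIntegral_indicator hU.measurableSet, inter_eq_right.2 hUab]
  have hV' : ∫ x in Ioo a b, V.indicator (fun x => (-f x) ^ 2 - 2 * ε * -f x) x ≤ 0 := by
    rwa [setIntegral_indicator hV.measurableSet, inter_eq_right.2 hVab]
  -- points lying in both sets are counted twice, which is harmless as the sum there is `2 f²`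
  have hle : ∫ x in Ioo a b, (f x ^ 2 - 2 * ε * |f x|)
      ≤ ∫ x in Ioo a b, (U.indicator (fun x => f x ^ 2 - 2 * ε * f x) x
        + V.indicator (fun x => (-f x) ^ 2 - 2 * ε * -f x) x) := by
    refine integral_mono_ae hi3 ((hi1.indicator hU.measurableSet).add
      (hi2.indicator hV.measurableSet)) ?_
    filter_upwards [ae_restrict_of_ae hUle, ae_restrict_of_ae hVle,
      ae_restrict_mem measurableSet_Ioo] with x hx1 hx2 hx
    have habs := abs_nonneg (f x)
    have h1 := mul_le_mul_of_nonneg_left (le_abs_self (f x)) hε.le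
    have h2 := mul_le_mul_of_nonneg_left (neg_le_abs (f x)) hε.le
    have h3 := mul_nonneg hε.le habs
    by_cases hxU : x ∈ U <;> by_cases hxV : x ∈ V <;> simp only [hxU, hxV, indicator_of_mem,
      indicator_of_notMem, not_false_eq_true]
    · nlinarith [sq_nonneg (f x)]
    · linarith
    · linarith
    · have h4 : |f x| ≤ ε := abs_le.2 ⟨by linarith [hx2 hx hxV], hx1 hx hxU⟩
      nlinarith [sq_abs (f x)]
  rw [integral_add (hi1.indicator hU.measurableSet) (hi2.indicator hV.measurableSet),
    integral_sub hf2 (hf.abs.const_mul _), integral_const_mul] at hle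
  linarith

/-- If the quadratic oscillation of `f` is at most `ε` on all subintervals of `(a, b)`, then the
variance of `f` is at most `2ε` times its mean absolute deviation. -/
theorem integral_sq_sub_average_le {f : ℝ → ℝ} {a b ε : ℝ} (hab : a < b) (hε : 0 < ε)
    (hf : IntegrableOn f (Ioo a b)) (hf2 : IntegrableOn (fun x => f x ^ 2) (Ioo a b))
    (hosc : ∀ c d : ℝ, a ≤ c → c < d → d ≤ b →
      ∫ x in Ioo c d, (f x - ⨍ y in Ioo c d, f y) ^ 2 ≤ ε ^ 2 * (d - c)) :
    ∫ x in Ioo a b, (f x - ⨍ y in Ioo a b, f y) ^ 2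
      ≤ 2 * ε * ∫ x in Ioo a b, |f x - ⨍ y in Ioo a b, f y| := by
  set m := ⨍ y in Ioo a b, f y with hm
  refine integral_sq_le_two_mul_integral_abs hab hε (hf.sub (integrableOn_Ioo_const m))
    (integrableOn_sq_sub_const hf hf2 m) (fun c d hac hcd hdb => ?_) ?_
  · refine le_of_eq_of_le ?_ (hosc c d hac hcd hdb)
    have hsub : Ioo c d ⊆ Ioo a b := Ioo_subset_Ioo hac hdb
    have : ⨍ y in Ioo c d, (f y - m) = (⨍ y in Ioo c d, f y) - m := by
      rw [setAverage_Ioo_eq hcd, setAverage_Ioo_eq hcd, integral_sub (hf.mono_set hsub)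
        (integrableOn_Ioo_const m), setIntegral_Ioo_const hcd.le, sub_div,
        mul_div_cancel_right₀ _ (sub_ne_zero.2 hcd.ne')]
    rw [this]
    exact integral_congr_ae (Eventually.of_forall fun x => by ring)
  · rw [integral_sub hf (integrableOn_Ioo_const m), setIntegral_Ioo_const hab.le,
      ← mul_setAverage_Ioo hab]
    ring

/-! ### Profiles -/

namespace IsProfile

variable {h : ℝ → ℝ}

theorem strictMonoOn (hh : IsProfile h) : StrictMonoOn h (Ici 0) := by
  apply strictMonoOn_of_deriv_pos (convex_Ici 0) hh.continuousOn
  intro x hx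
  rw [interior_Ici] at hx
  exact hh.deriv_pos x hx

theorem nonneg (hh : IsProfile h) {t : ℝ} (ht : 0 ≤ t) : 0 ≤ h t := hh.bijOn.mapsTo ht

theorem pos (hh : IsProfile h) {t : ℝ} (ht : 0 < t) : 0 < h t := by
  have := hh.strictMonoOn (mem_Ici.2 le_rfl) (mem_Ici.2 ht.le) ht
  rwa [hh.map_zero] at this

theorem concaveOn (hh : IsProfile h) : ConcaveOn ℝ (Ici 0) h := by
  refine concaveOn_of_deriv2_nonpos (convex_Ici 0) hh.continuousOn ?_ ?_ ?_ <;>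
    rw [interior_Ici] <;> intro t ht
  · exact (hh.differentiable₁ t ht).differentiableWithinAt
  · exact (hh.differentiable₂ t ht).differentiableWithinAt
  · exact (hh.deriv₂_neg t ht).le

theorem continuous_comp_abs (hh : IsProfile h) : Continuous fun t => h |t| :=
  hh.continuousOn.comp_continuous continuous_abs fun t => abs_nonneg t

theorem mul_deriv_le (hh : IsProfile h) {s : ℝ} (hs : 0 < s) : s * deriv h s ≤ h s := by
  have := hh.concaveOn.deriv_le_slope (mem_Ici.2 le_rfl) (mem_Ici.2 hs.le) hs
    (hh.differentiable₁ s hs)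
  rw [slope_def_field, hh.map_zero, le_div_iff₀ (by linarith)] at this
  linarith

/-- The quadratic polynomial which agrees with `h` at `0` and to first order at `s` lies below `h`,
because the difference has a simple zero at `0`, a double zero at `s`, and a positive third
derivative. -/
theorem quadratic_le (hh : IsProfile h) {s t : ℝ} (hs : 0 < s) (ht : 0 ≤ t) :
    (deriv h s / s - h s / s ^ 2) * t ^ 2 + (2 * h s / s - deriv h s) * t ≤ h t := by
  set α := deriv h s / s - h s / s ^ 2 with hα
  set β := 2 * h s / s - deriv h s with hβ
  set g : ℝ → ℝ := fun t => h t - (α * t ^ 2 + β * t) with hg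
  set g' : ℝ → ℝ := fun t => deriv h t - (2 * α * t + β) with hg'
  have hgd : ∀ x, 0 < x → HasDerivAt g (g' x) x := fun x hx => by
    have h1 := (hh.differentiable₁ x hx).hasDerivAt.sub
      ((((hasDerivAt_id x).pow 2).const_mul α).add ((hasDerivAt_id x).const_mul β))
    refine HasDerivAt.congr_deriv (f := g) h1 ?_
    simp only [hg', id, Nat.cast_ofNat, Nat.add_one_sub_one, pow_one, mul_one]
    ring
  have hgc : ContinuousOn g (Ici 0) := hh.continuousOn.sub (by fun_prop)
  have hg0 : g 0 = 0 := by simp [hg, hh.map_zero]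
  have hgs : g s = 0 := by
    simp only [hg, hα, hβ]
    field_simp
    ring
  have hg's : g' s = 0 := by
    simp only [hg', hα, hβ]
    field_simp
    ring
  have hconv : ConvexOn ℝ (Ioi 0) g' := by
    have h1 : ConvexOn ℝ (Ioi 0) (deriv h) := by
      refine convexOn_of_deriv2_nonneg (convex_Ioi 0) ?_ ?_ ?_ ?_
      · exact fun x hx => (hh.differentiable₂ x hx).continuousAt.continuousWithinAt
      all_goals rw [interior_Ioi]; intro x hx
      · exact (hh.differentiable₂ x hx).differentiableWithinAt
      · exact (hh.differentiable₃ x hx).differentiableWithinAt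
      · exact (hh.deriv₃_pos x hx).le
    have h2 : ConcaveOn ℝ (Ioi (0 : ℝ)) fun t => 2 * α * t + β :=
      ((LinearMap.mulLeft ℝ (2 * α)).concaveOn (convex_Ioi 0)).add_const β
    exact h1.sub h2
  obtain ⟨r, ⟨hr0, hrs⟩, hr⟩ := exists_hasDerivAt_eq_zero hs (hgc.mono Icc_subset_Ici_self)
    (hg0.trans hgs.symm) fun x hx => hgd x hx.1
  have hneg : ∀ x ∈ Ioo r s, g' x ≤ 0 := fun x hx => by
    have := hconv.le_max_of_mem_Icc (mem_Ioi.2 hr0) (mem_Ioi.2 hs) ⟨hx.1.le, hx.2.le⟩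
    rwa [hr, hg's, max_self] at this
  -- a convex function with zeros `r < s` is nonnegative outside of `[r, s]`
  have hpos1 : ∀ x ∈ Ioo 0 r, 0 ≤ g' x := fun x hx => by
    have := hconv.slope_mono_adjacent (mem_Ioi.2 hx.1) (mem_Ioi.2 hs) hx.2 hrs
    rw [hr, hg's, sub_zero, zero_div, div_le_iff₀ (by linarith [hx.2])] at this
    linarith
  have hpos2 : ∀ x ∈ Ioi s, 0 ≤ g' x := fun x hx => by
    have hx : s < x := hx
    have := hconv.slope_mono_adjacent (mem_Ioi.2 hr0) (mem_Ioi.2 (hs.trans hx)) hrs hx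
    rw [hr, hg's, sub_zero, zero_div, le_div_iff₀ (by linarith)] at this
    linarith
  have key : 0 ≤ g t := by
    rcases le_or_gt t r with htr | htr
    · have : MonotoneOn g (Icc 0 r) := by
        refine monotoneOn_of_deriv_nonneg (convex_Icc 0 r) (hgc.mono Icc_subset_Ici_self) ?_ ?_
        all_goals rw [interior_Icc]; intro x hx
        · exact (hgd x hx.1).differentiableAt.differentiableWithinAt
        · rw [(hgd x hx.1).deriv]
          exact hpos1 x hx
      exact hg0 ▸ this ⟨le_rfl, hr0.le⟩ ⟨ht, htr⟩ ht
    rcases le_or_gt t s with hts | hts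
    · have : AntitoneOn g (Icc r s) := by
        refine antitoneOn_of_deriv_nonpos (convex_Icc r s)
          (hgc.mono fun x hx => hr0.le.trans hx.1) ?_ ?_
        all_goals rw [interior_Icc]; intro x hx
        · exact (hgd x (hr0.trans hx.1)).differentiableAt.differentiableWithinAt
        · rw [(hgd x (hr0.trans hx.1)).deriv]
          exact hneg x hx
      exact hgs ▸ this ⟨htr.le, hts⟩ ⟨hrs.le, le_rfl⟩ hts
    · have : MonotoneOn g (Ici s) := by
        refine monotoneOn_of_deriv_nonneg (convex_Ici s)
          (hgc.mono fun x hx => hs.le.trans hx) ?_ ?_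
        all_goals rw [interior_Ici]; intro x hx
        · exact (hgd x (hs.trans hx)).differentiableAt.differentiableWithinAt
        · rw [(hgd x (hs.trans hx)).deriv]
          exact hpos2 x hx
      exact hgs ▸ this (mem_Ici.2 le_rfl) hts.le hts.le
  simp only [hg] at key
  linarith

theorem halfLineInv_nonneg (hh : IsProfile h) {y : ℝ} (hy : 0 ≤ y) : 0 ≤ halfLineInv h y :=
  Function.invFunOn_mem (hh.bijOn.surjOn hy)

theorem apply_halfLineInv (hh : IsProfile h) {y : ℝ} (hy : 0 ≤ y) : h (halfLineInv h y) = y :=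
  Function.invFunOn_eq (hh.bijOn.surjOn hy)

theorem halfLineInv_le (hh : IsProfile h) {y t : ℝ} (hy : 0 ≤ y) (ht : 0 ≤ t) (hyt : y ≤ h t) :
    halfLineInv h y ≤ t := by
  rw [← hh.strictMonoOn.le_iff_le (hh.halfLineInv_nonneg hy) ht, hh.apply_halfLineInv hy]
  exact hyt

theorem le_halfLineInv (hh : IsProfile h) {y t : ℝ} (hy : 0 ≤ y) (ht : 0 ≤ t) (hyt : h t ≤ y) :
    t ≤ halfLineInv h y := by
  rw [← hh.strictMonoOn.le_iff_le ht (hh.halfLineInv_nonneg hy), hh.apply_halfLineInv hy]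
  exact hyt

end IsProfile

/-! ### From small exceptional sets to bounded mean oscillation -/

/-- If `|f - k| ≤ A` off a set whose indicator function is dominated by a weight of mean at most
`1/64`, then the mean of `|f - k|` is controlled by `A` and an eighth of the standard deviation. -/
theorem integral_abs_sub_le {f w : ℝ → ℝ} {a b k A ε : ℝ} (hab : a < b) (hA : 0 < A)
    (hε : 0 < ε) (hf : IntegrableOn f (Ioo a b)) (hf2 : IntegrableOn (fun x => f x ^ 2) (Ioo a b))
    (hosc : ∫ x in Ioo a b, (f x - ⨍ y in Ioo a b, f y) ^ 2 ≤ ε ^ 2 * (b - a))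
    (hw : IntegrableOn w (Ioo a b)) (hw0 : ∀ x, 0 ≤ w x) (hw1 : ∀ x, A < |f x - k| → 1 ≤ w x)
    (hwint : ∫ x in Ioo a b, w x ≤ (b - a) / 64) :
    63 / 64 * ∫ x in Ioo a b, |f x - k| ≤ (A + ε / 8) * (b - a) ∧
      |(⨍ y in Ioo a b, f y) - k| * (b - a) ≤ ∫ x in Ioo a b, |f x - k| := by
  set m := ⨍ y in Ioo a b, f y with hm
  have hfk : IntegrableOn (fun x => f x - k) (Ioo a b) := hf.sub (integrableOn_Ioo_const k)
  have hmk : |m - k| * (b - a) ≤ ∫ x in Ioo a b, |f x - k| := by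
    have h1 : (m - k) * (b - a) = ∫ x in Ioo a b, (f x - k) := by
      rw [integral_sub hf (integrableOn_Ioo_const k), setIntegral_Ioo_const hab.le,
        ← mul_setAverage_Ioo hab]
      ring
    rw [← abs_of_pos (sub_pos.2 hab), ← abs_mul, h1]
    exact abs_integral_le_integral_abs
  refine ⟨?_, hmk⟩
  have hi1 : IntegrableOn (fun x => (f x - m) ^ 2 / (16 * ε)) (Ioo a b) :=
    (integrableOn_sq_sub_const hf hf2 m).div_const _
  have hi2 : IntegrableOn (fun x => (4 * ε + |m - k|) * w x) (Ioo a b) := hw.const_mul _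
  have hi3 : IntegrableOn (fun x => A + (f x - m) ^ 2 / (16 * ε)) (Ioo a b) :=
    (integrableOn_Ioo_const A).add hi1
  have hle : ∫ x in Ioo a b, |f x - k| ≤
      ∫ x in Ioo a b, (A + (f x - m) ^ 2 / (16 * ε) + (4 * ε + |m - k|) * w x) := by
    refine integral_mono hfk.abs (hi3.add hi2) fun x => ?_
    have h0 : 0 ≤ (f x - m) ^ 2 / (16 * ε) := by positivity
    have h1 : 0 ≤ (4 * ε + |m - k|) := by positivity
    have h2 := hw0 x
    simp only
    rcases le_or_gt (|f x - k|) A with hx | hx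
    · have := mul_nonneg h1 h2
      linarith
    · have h3 := mul_le_mul_of_nonneg_left (hw1 x hx) h1
      have h4 : |f x - k| ≤ |f x - m| + |m - k| := abs_sub_le _ _ _
      -- `|u| ≤ u² / (16 ε) + 4 ε` by the inequality of the means
      have h5 : |f x - m| ≤ (f x - m) ^ 2 / (16 * ε) + 4 * ε := by
        rw [← sub_le_iff_le_add, le_div_iff₀ (by positivity)]
        nlinarith [sq_abs (f x - m), sq_nonneg (|f x - m| - 8 * ε)]
      linarith
  rw [integral_add hi3 hi2, integral_add (integrableOn_Ioo_const A) hi1, integral_const_mul,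
    integral_div, setIntegral_Ioo_const hab.le] at hle
  have h6 : (∫ x in Ioo a b, (f x - m) ^ 2) / (16 * ε) ≤ ε / 16 * (b - a) := by
    rw [div_le_iff₀ (by positivity)]
    linarith
  have h7 := mul_le_mul_of_nonneg_left hwint (show 0 ≤ 4 * ε + |m - k| by positivity)
  linarith

/-- The a priori bound: for a bounded function, the oscillation is bounded in terms of `A` only. If
`ε` is the largest oscillation, then comparison of the quadratic with the linear oscillation gives
`ε² ≤ 4 · (64/63) · ε (A + ε/8)`. -/
theorem integral_sq_sub_average_le_of_weights {f : ℝ → ℝ} {a b A N : ℝ} (hA : 0 < A)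
    (hfm : AEStronglyMeasurable f (volume.restrict (Ioo a b))) (hfN : ∀ x, |f x| ≤ N)
    (hw : ∀ c d : ℝ, a ≤ c → c < d → d ≤ b → ∃ (k : ℝ) (w : ℝ → ℝ), IntegrableOn w (Ioo c d) ∧
      (∀ x, 0 ≤ w x) ∧ (∀ x, A < |f x - k| → 1 ≤ w x) ∧ ∫ x in Ioo c d, w x ≤ (d - c) / 64)
    {c d : ℝ} (hac : a ≤ c) (hcd : c < d) (hdb : d ≤ b) :
    ∫ x in Ioo c d, (f x - ⨍ y in Ioo c d, f y) ^ 2 ≤ (9 * A) ^ 2 * (d - c) := by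
  have hf : IntegrableOn f (Ioo a b) :=
    Integrable.mono' (integrableOn_Ioo_const N) hfm (Eventually.of_forall hfN)
  have hfN2 : ∀ x, f x ^ 2 ≤ N ^ 2 := fun x => sq_le_sq' (abs_le.1 (hfN x)).1 (abs_le.1 (hfN x)).2
  have hf2 : IntegrableOn (fun x => f x ^ 2) (Ioo a b) := by
    refine Integrable.mono' (integrableOn_Ioo_const (N ^ 2)) (hfm.pow 2)
      (Eventually.of_forall fun x => ?_)
    rw [Real.norm_eq_abs, abs_of_nonneg (sq_nonneg _)]
    exact hfN2 x
  set T : Set ℝ := {v | ∃ p q : ℝ, a ≤ p ∧ p < q ∧ q ≤ b ∧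
    v = (∫ x in Ioo p q, (f x - ⨍ y in Ioo p q, f y) ^ 2) / (q - p)} with hT
  have hTb : BddAbove T := by
    refine ⟨N ^ 2, ?_⟩
    rintro _ ⟨p, q, hap, hpq, hqb, rfl⟩
    have hsub : Ioo p q ⊆ Ioo a b := Ioo_subset_Ioo hap hqb
    rw [div_le_iff₀ (sub_pos.2 hpq)]
    refine (integral_sq_sub_setAverage_le hpq (hf.mono_set hsub) (hf2.mono_set hsub) 0).trans ?_
    rw [← setIntegral_Ioo_const hpq.le]
    exact integral_mono (integrableOn_sq_sub_const (hf.mono_set hsub) (hf2.mono_set hsub) 0)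
      (integrableOn_Ioo_const _)
      fun x => by simpa using hfN2 x
  have hTle : ∀ p q : ℝ, a ≤ p → p < q → q ≤ b →
      ∫ x in Ioo p q, (f x - ⨍ y in Ioo p q, f y) ^ 2 ≤ sSup T * (q - p) := by
    intro p q hap hpq hqb
    rw [← div_le_iff₀ (sub_pos.2 hpq)]
    exact le_csSup hTb ⟨p, q, hap, hpq, hqb, rfl⟩
  have hTne : T.Nonempty := ⟨_, c, d, hac, hcd, hdb, rfl⟩
  refine (hTle c d hac hcd hdb).trans
    (mul_le_mul_of_nonneg_right ?_ (sub_nonneg.2 hcd.le))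
  rcases le_or_gt (sSup T) 0 with h0 | h0
  · exact h0.trans (sq_nonneg _)
  set ε := √(sSup T) with hεdef
  have hε : 0 < ε := Real.sqrt_pos.2 h0
  have hε2 : ε ^ 2 = sSup T := Real.sq_sqrt h0.le
  rw [← hε2]
  have hbound : ε ^ 2 ≤ 4 * ε * (64 / 63 * (A + ε / 8)) := by
    rw [hε2]
    refine csSup_le hTne ?_
    rintro _ ⟨p, q, hap, hpq, hqb, rfl⟩
    have hsub : Ioo p q ⊆ Ioo a b := Ioo_subset_Ioo hap hqb
    have hfp := hf.mono_set hsub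
    have hf2p := hf2.mono_set hsub
    obtain ⟨k, w, hwi, hw0, hw1, hwint⟩ := hw p q hap hpq hqb
    obtain ⟨h1, h2⟩ := integral_abs_sub_le hpq hA hε hfp hf2p
      (hε2 ▸ hTle p q hap hpq hqb) hwi hw0 hw1 hwint
    have h3 := integral_sq_sub_average_le hpq hε hfp hf2p fun p' q' hp' hpq' hq' =>
      hε2 ▸ hTle p' q' (hap.trans hp') hpq' (hq'.trans hqb)
    set m := ⨍ y in Ioo p q, f y with hm
    have hfk : IntegrableOn (fun x => |f x - k|) (Ioo p q) :=
      (hfp.sub (integrableOn_Ioo_const k)).abs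
    have h4 : ∫ x in Ioo p q, |f x - m| ≤ ∫ x in Ioo p q, (|f x - k| + |m - k|) := by
      refine integral_mono (hfp.sub (integrableOn_Ioo_const m)).abs
        (hfk.add (integrableOn_Ioo_const _)) fun x => ?_
      simp only
      rw [abs_sub_comm m k]
      exact abs_sub_le _ _ _
    rw [integral_add hfk (integrableOn_Ioo_const _),
      setIntegral_Ioo_const hpq.le] at h4
    rw [div_le_iff₀ (sub_pos.2 hpq)]
    refine h3.trans ?_
    have h5 : ∫ x in Ioo p q, |f x - m| ≤ 2 * (64 / 63 * ((A + ε / 8) * (q - p))) := by linarith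
    nlinarith [mul_le_mul_of_nonneg_left h5 hε.le]
  have h9 : ε ≤ 9 * A := by
    have : ε ≤ 4 * (64 / 63 * (A + ε / 8)) := by
      refine le_of_mul_le_mul_left ?_ hε
      nlinarith
    linarith
  gcongr

theorem abs_clamp_sub_clamp_le {N : ℝ} (x y : ℝ) :
    |max (-N) (min N x) - max (-N) (min N y)| ≤ |x - y| := by
  refine (abs_max_sub_max_le_max _ _ _ _).trans (max_le (by simp) ?_)
  exact (abs_min_sub_min_le_max _ _ _ _).trans (max_le (by simp) le_rfl)

/-- A function which is close to a constant on each interval, off an exceptional set of small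
relative measure, is square integrable: the a priori bound applies to its truncations. -/
theorem integrableOn_sq_of_weights {f : ℝ → ℝ} {a b A : ℝ} (hA : 0 < A) (hab : a < b)
    (hfm : AEStronglyMeasurable f (volume.restrict (Ioo a b)))
    (hw : ∀ c d : ℝ, a ≤ c → c < d → d ≤ b → ∃ (k : ℝ) (w : ℝ → ℝ), IntegrableOn w (Ioo c d) ∧
      (∀ x, 0 ≤ w x) ∧ (∀ x, A < |f x - k| → 1 ≤ w x) ∧ ∫ x in Ioo c d, w x ≤ (d - c) / 64) :
    IntegrableOn f (Ioo a b) ∧ IntegrableOn (fun x => f x ^ 2) (Ioo a b) ∧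
      ∫ x in Ioo a b, (f x - ⨍ y in Ioo a b, f y) ^ 2 ≤ 90 * A ^ 2 * (b - a) := by
  obtain ⟨k, w, hwi, hw0, hw1, hwint⟩ := hw a b le_rfl hab le_rfl
  set τ : ℕ → ℝ → ℝ := fun N x => max (-(N : ℝ)) (min (N : ℝ) x) with hτ
  have hτc : ∀ N, Continuous (τ N) := fun N => by fun_prop
  have hτN : ∀ N x, |τ N x| ≤ N := fun N x =>
    abs_le.2 ⟨le_max_left _ _, max_le (by linarith [Nat.cast_nonneg (α := ℝ) N]) (min_le_left _ _)⟩
  have hτlim : ∀ x, ∀ᶠ N in atTop, τ N x = x := fun x => by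
    filter_upwards [(tendsto_natCast_atTop_atTop (R := ℝ)).eventually_ge_atTop |x|] with N hN
    have := abs_le.1 hN
    simp only [hτ]
    rw [min_eq_right this.2, max_eq_right this.1]
  have hbound : ∀ N, IntegrableOn (fun x => (τ N (f x) - τ N k) ^ 2) (Ioo a b) ∧
      ∫ x in Ioo a b, (τ N (f x) - τ N k) ^ 2 ≤ 90 * A ^ 2 * (b - a) := by
    intro N
    have hgm : AEStronglyMeasurable (fun x => τ N (f x)) (volume.restrict (Ioo a b)) :=
      (hτc N).comp_aestronglyMeasurable hfm
    have hgi : IntegrableOn (fun x => τ N (f x)) (Ioo a b) :=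
      Integrable.mono' (integrableOn_Ioo_const (N : ℝ)) hgm
        (Eventually.of_forall fun x => hτN N _)
    have hgi2 : IntegrableOn (fun x => τ N (f x) ^ 2) (Ioo a b) := by
      refine Integrable.mono' (integrableOn_Ioo_const ((N : ℝ) ^ 2)) (hgm.pow 2)
        (Eventually.of_forall fun x => ?_)
      rw [Real.norm_eq_abs, abs_pow]
      exact pow_le_pow_left₀ (abs_nonneg _) (hτN N _) 2
    have hosc := integral_sq_sub_average_le_of_weights hA hgm (fun x => hτN N (f x))
      (fun c d hac hcd hdb => by
        obtain ⟨k, w, hwi, hw0, hw1, hwint⟩ := hw c d hac hcd hdb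
        exact ⟨τ N k, w, hwi, hw0,
          fun x hx => hw1 x (hx.trans_le (abs_clamp_sub_clamp_le _ _)), hwint⟩)
      le_rfl hab le_rfl
    obtain ⟨h1, h2⟩ := integral_abs_sub_le (k := τ N k) hab hA (by positivity : 0 < 9 * A) hgi hgi2
      hosc hwi hw0 (fun x hx => hw1 x (hx.trans_le (abs_clamp_sub_clamp_le _ _))) hwint
    refine ⟨integrableOn_sq_sub_const hgi hgi2 _, ?_⟩
    set m := ⨍ y in Ioo a b, τ N (f y) with hm
    have hmk : |m - τ N k| ≤ 3 * A := by
      refine le_of_mul_le_mul_right ?_ (sub_pos.2 hab)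
      nlinarith [mul_pos hA (sub_pos.2 hab)]
    have hmk2 : (m - τ N k) ^ 2 ≤ 9 * A ^ 2 := by
      rw [← sq_abs]
      nlinarith [abs_nonneg (m - τ N k)]
    rw [integral_sq_sub_const hab.le hgi hgi2, ← mul_setAverage_Ioo hab (fun y => τ N (f y)),
      ← hm] at hosc ⊢
    nlinarith [mul_le_mul_of_nonneg_right hmk2 (sub_pos.2 hab).le]
  have hlint : ∫⁻ x in Ioo a b, ENNReal.ofReal ((f x - k) ^ 2)
      ≤ ENNReal.ofReal (90 * A ^ 2 * (b - a)) := by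
    have hfatou := lintegral_liminf_le' (μ := volume.restrict (Ioo a b)) (u := atTop)
      (f := fun N x => ENNReal.ofReal ((τ N (f x) - τ N k) ^ 2))
      fun N => (hbound N).1.aestronglyMeasurable.aemeasurable.ennreal_ofReal
    have hlim : ∀ x, liminf (fun N => ENNReal.ofReal ((τ N (f x) - τ N k) ^ 2)) atTop
        = ENNReal.ofReal ((f x - k) ^ 2) := fun x => by
      refine Tendsto.liminf_eq (tendsto_const_nhds.congr' ?_)
      filter_upwards [hτlim (f x), hτlim k] with N h1 h2
      rw [h1, h2]
    simp only [hlim] at hfatou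
    refine hfatou.trans (liminf_le_of_le (by isBoundedDefault) fun y hy => ?_)
    obtain ⟨N, hN⟩ := hy.exists
    refine hN.trans ?_
    rw [← ofReal_integral_eq_lintegral_ofReal (hbound N).1
      (Eventually.of_forall fun x => sq_nonneg _)]
    exact ENNReal.ofReal_le_ofReal (hbound N).2
  have hkm : AEStronglyMeasurable (fun x => f x - k) (volume.restrict (Ioo a b)) :=
    hfm.sub aestronglyMeasurable_const
  have hk2 : IntegrableOn (fun x => (f x - k) ^ 2) (Ioo a b) := by
    refine ⟨hkm.pow 2, ?_⟩
    rw [hasFiniteIntegral_iff_ofReal (Eventually.of_forall fun x => sq_nonneg _)]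
    exact hlint.trans_lt ENNReal.ofReal_lt_top
  have hk1 : IntegrableOn (fun x => f x - k) (Ioo a b) := by
    refine Integrable.mono' ((integrableOn_Ioo_const 1).add hk2) hkm
      (Eventually.of_forall fun x => ?_)
    rw [Real.norm_eq_abs, Pi.add_apply]
    nlinarith [sq_abs (f x - k), sq_nonneg (|f x - k| - 1), abs_nonneg (f x - k)]
  have hf : IntegrableOn f (Ioo a b) :=
    (hk1.add (integrableOn_Ioo_const k)).congr_fun (fun x _ => by simp) measurableSet_Ioo
  have hf2 : IntegrableOn (fun x => f x ^ 2) (Ioo a b) := by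
    refine (integrableOn_sq_sub_const hk1 hk2 (-k)).congr_fun (fun x _ => ?_) measurableSet_Ioo
    simp
  refine ⟨hf, hf2, (integral_sq_sub_setAverage_le hab hf hf2 k).trans ?_⟩
  rw [← ofReal_integral_eq_lintegral_ofReal hk2 (Eventually.of_forall fun x => sq_nonneg _),
    ENNReal.ofReal_le_ofReal_iff (by have := sub_pos.2 hab; positivity)] at hlint
  exact hlint

/-! ### The seminorms as bounds for integrals -/

theorem setLAverage_ofReal_Ioo {g : ℝ → ℝ} {a b : ℝ} (hab : a < b) (hg : IntegrableOn g (Ioo a b))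
    (hg0 : ∀ x, 0 ≤ g x) :
    ⨍⁻ x in Ioo a b, ENNReal.ofReal (g x) ∂volume =
      ENNReal.ofReal ((∫ x in Ioo a b, g x) / (b - a)) := by
  rw [setLAverage_eq, ← ofReal_setAverage hg (Eventually.of_forall hg0), setAverage_Ioo_eq hab]

theorem bmoNorm_le {Q : Set ℝ} {φ : ℝ → ℝ} {ε : ℝ} (hε : 0 ≤ ε)
    (h : ∀ a b : ℝ, a < b → Ioo a b ⊆ Q →
      IntegrableOn (fun x => (φ x - ⨍ y in Ioo a b, φ y) ^ 2) (Ioo a b) ∧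
      ∫ x in Ioo a b, (φ x - ⨍ y in Ioo a b, φ y) ^ 2 ≤ ε ^ 2 * (b - a)) :
    bmoNorm Q φ ≤ ENNReal.ofReal ε := by
  refine iSup_le fun a => iSup_le fun b => iSup_le fun hab => iSup_le fun hQ => ?_
  obtain ⟨h1, h2⟩ := h a b hab hQ
  simp only [sq_abs]
  rw [setLAverage_ofReal_Ioo hab h1 fun x => sq_nonneg _]
  calc _ ≤ ENNReal.ofReal (ε ^ 2) ^ (1 / 2 : ℝ) := by
        gcongr
        rwa [div_le_iff₀ (sub_pos.2 hab)]
    _ = ENNReal.ofReal ε := by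
        rw [ENNReal.ofReal_rpow_of_nonneg (sq_nonneg _) (by norm_num), ← Real.sqrt_eq_rpow,
          Real.sqrt_sq hε]

theorem integral_sq_le_bmoNorm {Q : Set ℝ} {φ : ℝ → ℝ} (hfin : bmoNorm Q φ < ∞) {a b : ℝ}
    (hab : a < b) (hQ : Ioo a b ⊆ Q)
    (hi : IntegrableOn (fun x => (φ x - ⨍ y in Ioo a b, φ y) ^ 2) (Ioo a b)) :
    ∫ x in Ioo a b, (φ x - ⨍ y in Ioo a b, φ y) ^ 2 ≤ (bmoNorm Q φ).toReal ^ 2 * (b - a) := by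
  have h1 :
      (⨍⁻ x in Ioo a b, ENNReal.ofReal (|φ x - ⨍ y in Ioo a b, φ y| ^ 2) ∂volume) ^ (1 / 2 : ℝ)
      ≤ bmoNorm Q φ :=
    le_iSup_of_le a (le_iSup_of_le b (le_iSup_of_le hab (le_iSup_of_le hQ le_rfl)))
  simp only [sq_abs] at h1
  have h0 : 0 ≤ (∫ x in Ioo a b, (φ x - ⨍ y in Ioo a b, φ y) ^ 2) / (b - a) :=
    div_nonneg (integral_nonneg fun x => sq_nonneg _) (sub_pos.2 hab).le
  rw [setLAverage_ofReal_Ioo hab hi fun x => sq_nonneg _,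
    ENNReal.ofReal_rpow_of_nonneg h0 (by norm_num), ← Real.sqrt_eq_rpow,
    ENNReal.ofReal_le_iff_le_toReal hfin.ne, Real.sqrt_le_left ENNReal.toReal_nonneg,
    div_le_iff₀ (sub_pos.2 hab)] at h1
  exact h1

theorem KSup_le {h : ℝ → ℝ} (hh : IsProfile h) {Q : Set ℝ} {φ : ℝ → ℝ} {κ : ℝ}
    (H : ∀ a b : ℝ, a < b → Ioo a b ⊆ Q →
      IntegrableOn (fun x => h |φ x - ⨍ y in Ioo a b, φ y|) (Ioo a b) ∧
      ∫ x in Ioo a b, h |φ x - ⨍ y in Ioo a b, φ y| ≤ κ * (b - a)) :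
    KSup h Q φ ≤ ENNReal.ofReal κ := by
  refine iSup_le fun a => iSup_le fun b => iSup_le fun hab => iSup_le fun hQ => ?_
  obtain ⟨h1, h2⟩ := H a b hab hQ
  rw [setLAverage_ofReal_Ioo hab h1 fun x => hh.nonneg (abs_nonneg _)]
  gcongr
  rwa [div_le_iff₀ (sub_pos.2 hab)]

theorem integral_le_KSup {h : ℝ → ℝ} (hh : IsProfile h) {Q : Set ℝ} {φ : ℝ → ℝ}
    (hm : AEStronglyMeasurable φ (volume.restrict Q)) (hfin : KSup h Q φ < ∞) {a b : ℝ}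
    (hab : a < b) (hQ : Ioo a b ⊆ Q) :
    IntegrableOn (fun x => h |φ x - ⨍ y in Ioo a b, φ y|) (Ioo a b) ∧
      ∫ x in Ioo a b, h |φ x - ⨍ y in Ioo a b, φ y| ≤ (KSup h Q φ).toReal * (b - a) := by
  have hle : ⨍⁻ x in Ioo a b, ENNReal.ofReal (h |φ x - ⨍ y in Ioo a b, φ y|) ∂volume ≤ KSup h Q φ :=
    le_iSup_of_le a (le_iSup_of_le b (le_iSup_of_le hab (le_iSup_of_le hQ le_rfl)))
  have h0 : ∀ x, 0 ≤ h |φ x - ⨍ y in Ioo a b, φ y| := fun x => hh.nonneg (abs_nonneg _)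
  have hi : IntegrableOn (fun x => h |φ x - ⨍ y in Ioo a b, φ y|) (Ioo a b) := by
    refine ⟨hh.continuous_comp_abs.comp_aestronglyMeasurable
      ((hm.mono_set hQ).sub aestronglyMeasurable_const), ?_⟩
    rw [hasFiniteIntegral_iff_ofReal (Eventually.of_forall h0)]
    have hlt := hle.trans_lt hfin
    rw [setLAverage_eq] at hlt
    refine lt_top_iff_ne_top.2 fun htop => ?_
    rw [htop, ENNReal.top_div_of_ne_top (by simp)] at hlt
    exact lt_irrefl _ hlt
  refine ⟨hi, ?_⟩
  rwa [setLAverage_ofReal_Ioo hab hi h0, ENNReal.ofReal_le_iff_le_toReal hfin.ne,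
    div_le_iff₀ (sub_pos.2 hab)] at hle

/-! ### Oscillation measured by a profile -/

theorem IsProfile.le_mul_one_add {h : ℝ → ℝ} (hh : IsProfile h) {t : ℝ} (ht : 0 ≤ t) :
    h t ≤ h 1 * (1 + t) := by
  have h1 := hh.pos one_pos
  rcases le_or_gt t 1 with h2 | h2
  · have := hh.strictMonoOn.monotoneOn ht (mem_Ici.2 zero_le_one) h2
    nlinarith
  · have := hh.concaveOn.slope_anti_adjacent (mem_Ici.2 le_rfl) (mem_Ici.2 ht) one_pos h2
    rw [hh.map_zero, div_le_div_iff₀ (by linarith) (by linarith)] at this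
    nlinarith

theorem IsProfile.integrableOn_comp_abs {h : ℝ → ℝ} (hh : IsProfile h) {f : ℝ → ℝ} {a b : ℝ}
    (hf : IntegrableOn f (Ioo a b)) : IntegrableOn (fun x => h |f x|) (Ioo a b) := by
  refine Integrable.mono' (((integrableOn_Ioo_const 1).add hf.abs).const_mul (h 1))
    (hh.continuous_comp_abs.comp_aestronglyMeasurable hf.aestronglyMeasurable)
    (Eventually.of_forall fun x => ?_)
  rw [Real.norm_eq_abs, abs_of_nonneg (hh.nonneg (abs_nonneg _))]
  exact hh.le_mul_one_add (abs_nonneg _)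

/-- Jensen's inequality for `h` and for the square. -/
theorem IsProfile.integral_comp_abs_le {h : ℝ → ℝ} (hh : IsProfile h) {f : ℝ → ℝ} {a b ε : ℝ}
    (hab : a < b) (hε : 0 ≤ ε) (hf : IntegrableOn f (Ioo a b))
    (hf2 : IntegrableOn (fun x => f x ^ 2) (Ioo a b))
    (hle : ∫ x in Ioo a b, f x ^ 2 ≤ ε ^ 2 * (b - a)) :
    ∫ x in Ioo a b, h |f x| ≤ h ε * (b - a) := by
  have hL := sub_pos.2 hab
  have hJ : ⨍ x in Ioo a b, h |f x| ≤ h (⨍ x in Ioo a b, |f x|) :=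
    hh.concaveOn.le_map_set_average hh.continuousOn isClosed_Ici (by simp [hab]) (by simp)
      (Eventually.of_forall fun x => mem_Ici.2 (abs_nonneg (f x))) hf.abs
      (hh.integrableOn_comp_abs hf)
  have hm0 : 0 ≤ ⨍ x in Ioo a b, |f x| := by
    rw [setAverage_Ioo_eq hab]
    exact div_nonneg (integral_nonneg fun x => abs_nonneg _) hL.le
  have hm : ⨍ x in Ioo a b, |f x| ≤ ε := by
    refine abs_le_of_sq_le_sq' ?_ hε |>.2
    have h2 : IntegrableOn (fun x => |f x| ^ 2) (Ioo a b) := by simpa only [sq_abs] using hf2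
    have h1 := integral_sq_sub_const hab.le hf.abs h2 (⨍ x in Ioo a b, |f x|)
    have h3 : 0 ≤ ∫ x in Ioo a b, (|f x| - ⨍ x in Ioo a b, |f x|) ^ 2 :=
      integral_nonneg fun x => sq_nonneg _
    rw [h1, ← mul_setAverage_Ioo hab (fun x => |f x|)] at h3
    simp only [sq_abs] at h3
    refine le_of_mul_le_mul_right ?_ hL
    linarith
  rw [← mul_setAverage_Ioo hab, mul_comm]
  exact mul_le_mul_of_nonneg_right
    (hJ.trans (hh.strictMonoOn.monotoneOn hm0 hε hm)) hL.le

/-- The lower estimate of the `h`-oscillation: replace `h` by its quadratic minorant at `2ε`, and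
estimate the first moment in it from below by the second one. -/
theorem IsProfile.mul_integral_sq_le {h : ℝ → ℝ} (hh : IsProfile h) {f : ℝ → ℝ} {a b ε : ℝ}
    (hab : a < b) (hε : 0 < ε) (hf : IntegrableOn f (Ioo a b))
    (hf2 : IntegrableOn (fun x => f x ^ 2) (Ioo a b))
    (hosc : ∀ c d : ℝ, a ≤ c → c < d → d ≤ b →
      ∫ x in Ioo c d, (f x - ⨍ y in Ioo c d, f y) ^ 2 ≤ ε ^ 2 * (d - c)) :
    (∫ x in Ioo a b, (f x - ⨍ y in Ioo a b, f y) ^ 2) / (4 * ε ^ 2) * h (2 * ε)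
      ≤ ∫ x in Ioo a b, h |f x - ⨍ y in Ioo a b, f y| := by
  have hV := integral_sq_sub_average_le hab hε hf hf2 hosc
  set m := ⨍ y in Ioo a b, f y with hm
  have hfm : IntegrableOn (fun x => f x - m) (Ioo a b) := hf.sub (integrableOn_Ioo_const m)
  have hfm2 := integrableOn_sq_sub_const hf hf2 m
  have hs : 0 < 2 * ε := by positivity
  set s := 2 * ε with hsdef
  have hβ : 0 ≤ 2 * h s / s - deriv h s := by
    have h1 := hh.mul_deriv_le hs
    have h2 := hh.pos hs
    rw [sub_nonneg, le_div_iff₀ hs]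
    linarith
  set α := deriv h s / s - h s / s ^ 2 with hα
  set β := 2 * h s / s - deriv h s with hβdef
  have hle : ∫ x in Ioo a b, (α * (f x - m) ^ 2 + β * |f x - m|)
      ≤ ∫ x in Ioo a b, h |f x - m| := by
    refine integral_mono ((hfm2.const_mul α).add (hfm.abs.const_mul β))
      (hh.integrableOn_comp_abs hfm) fun x => ?_
    have := hh.quadratic_le hs (abs_nonneg (f x - m))
    rwa [sq_abs] at this
  rw [integral_add (hfm2.const_mul α) (hfm.abs.const_mul β), integral_const_mul,
    integral_const_mul] at hle
  refine le_trans ?_ hle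
  set V := ∫ x in Ioo a b, (f x - m) ^ 2 with hVdef
  have h4 : V / s ≤ ∫ x in Ioo a b, |f x - m| := by
    rw [div_le_iff₀ hs]
    linarith
  calc V / (4 * ε ^ 2) * h s = V / s ^ 2 * h s := by rw [hsdef]; ring
    _ = α * V + β * (V / s) := by
      rw [hα, hβdef]
      field_simp
      ring
    _ ≤ _ := by gcongr

/-- Finiteness of the `h`-oscillation implies bounded mean oscillation: by Chebyshev's inequality,
`h(|φ - ⟨φ⟩_J|) / h(A)` is a weight of mean at most `1/64` for large `A`. Nothing is assumed about
the integrability of `φ` up to the end points of `J`, so `⟨φ⟩_J` is just some constant here. -/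
theorem exists_bound_of_KSup_lt_top {h : ℝ → ℝ} (hh : IsProfile h) {Q : Set ℝ} {φ : ℝ → ℝ}
    (hm : AEStronglyMeasurable φ (volume.restrict Q)) (hfin : KSup h Q φ < ∞) :
    ∃ A : ℝ, 0 < A ∧ ∀ a b : ℝ, a < b → Ioo a b ⊆ Q →
      IntegrableOn φ (Ioo a b) ∧ IntegrableOn (fun x => φ x ^ 2) (Ioo a b) ∧
      ∫ x in Ioo a b, (φ x - ⨍ y in Ioo a b, φ y) ^ 2 ≤ 90 * A ^ 2 * (b - a) := by
  set K := (KSup h Q φ).toReal with hK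
  obtain ⟨A, hAK, hA⟩ :=
    ((hh.tendsto_atTop.eventually_ge_atTop (64 * K)).and (eventually_gt_atTop 0)).exists
  have hhA := hh.pos hA
  refine ⟨A, hA, fun a b hab hQ => integrableOn_sq_of_weights hA hab (hm.mono_set hQ)
    fun c d hac hcd hdb => ?_⟩
  obtain ⟨h1, h2⟩ := integral_le_KSup hh hm hfin hcd ((Ioo_subset_Ioo hac hdb).trans hQ)
  refine ⟨⨍ y in Ioo c d, φ y, fun x => h |φ x - ⨍ y in Ioo c d, φ y| / h A, h1.div_const _,
    fun x => div_nonneg (hh.nonneg (abs_nonneg _)) hhA.le, fun x hx => ?_, ?_⟩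
  · rw [one_le_div hhA]
    exact hh.strictMonoOn.monotoneOn (mem_Ici.2 hA.le) (mem_Ici.2 (abs_nonneg _)) hx.le
  · rw [integral_div, div_le_div_iff₀ hhA (by norm_num)]
    nlinarith [mul_le_mul_of_nonneg_right hAK (sub_pos.2 hcd).le]

/-- A function without oscillation on any subinterval is constant. -/
theorem isConstantOn_of_integral_sq_nonpos {Q : Set ℝ} {φ : ℝ → ℝ} (hQ : Q.OrdConnected)
    (H : ∀ a b : ℝ, a < b → Ioo a b ⊆ Q →
      IntegrableOn (fun x => (φ x - ⨍ y in Ioo a b, φ y) ^ 2) (Ioo a b) ∧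
      ∫ x in Ioo a b, (φ x - ⨍ y in Ioo a b, φ y) ^ 2 ≤ 0) : IsConstantOn Q φ := by
  have hae : ∀ a b : ℝ, a < b → Ioo a b ⊆ Q →
      ∀ᵐ x ∂volume.restrict (Ioo a b), φ x = ⨍ y in Ioo a b, φ y := fun a b hab hsub => by
    obtain ⟨h1, h2⟩ := H a b hab hsub
    have h3 := (integral_eq_zero_iff_of_nonneg (fun x => sq_nonneg _) h1).1
      (h2.antisymm (integral_nonneg fun x => sq_nonneg _))
    filter_upwards [h3] with x hx
    exact sub_eq_zero.1 (pow_eq_zero_iff two_ne_zero |>.1 hx)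
  by_cases hne : ∃ p ∈ Q, ∃ q ∈ Q, p < q
  · obtain ⟨p, hp, q, hq, hpq⟩ := hne
    refine ⟨⨍ y in Ioo p q, φ y, ?_⟩
    rw [EventuallyEq, ae_restrict_iff' hQ.measurableSet]
    refine ae_of_mem_of_ae_of_mem_inter_Ioo fun a b ha hb hab => ?_
    have hsub : Ioo (min a p) (max b q) ⊆ Q := Ioo_subset_Icc_self.trans
      (hQ.out (by rcases min_choice a p with h | h <;> rw [h] <;> assumption)
        (by rcases max_choice b q with h | h <;> rw [h] <;> assumption))
    have hlt : min a p < max b q := (min_le_left _ _).trans_lt (hab.trans_le (le_max_left _ _))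
    have h1 := hae _ _ hlt hsub
    set c := ⨍ y in Ioo (min a p) (max b q), φ y with hc
    have h2 : ⨍ y in Ioo p q, φ y = c := by
      rw [setAverage_Ioo_eq hpq, integral_congr_ae (ae_restrict_of_ae_restrict_of_subset
        (Ioo_subset_Ioo (min_le_right _ _) (le_max_right _ _)) h1), setIntegral_Ioo_const hpq.le,
        mul_div_cancel_right₀ _ (sub_ne_zero.2 hpq.ne')]
    rw [h2]
    rw [ae_restrict_iff' measurableSet_Ioo] at h1
    filter_upwards [h1] with x hx hxab
    exact hx (Ioo_subset_Ioo (min_le_left _ _) (le_max_left _ _) hxab.2)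
  · push Not at hne
    refine ⟨0, ?_⟩
    rw [EventuallyEq, ae_restrict_iff' hQ.measurableSet]
    exact ae_of_mem_of_ae_of_mem_inter_Ioo fun a b ha hb hab =>
      absurd hab (hne a ha b hb).not_gt

theorem setAverage_sq_sub_sq {f : ℝ → ℝ} {a b : ℝ} (hab : a < b) (hf : IntegrableOn f (Ioo a b))
    (hf2 : IntegrableOn (fun x => f x ^ 2) (Ioo a b)) :
    (⨍ x in Ioo a b, f x ^ 2) - (⨍ x in Ioo a b, f x) ^ 2
      = (∫ x in Ioo a b, (f x - ⨍ y in Ioo a b, f y) ^ 2) / (b - a) := by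
  have hL := sub_pos.2 hab
  rw [integral_sq_sub_const hab.le hf hf2, ← mul_setAverage_Ioo hab f,
    ← mul_setAverage_Ioo hab (fun x => f x ^ 2)]
  field_simp
  ring

/-! ### The step function -/

theorem comp_stepFun {a b : ℝ} (hab : a < b) (t : ℝ) {g : ℝ → ℝ} (hg : g 0 = 0) (x : ℝ) :
    g (stepFun a b t x) = (Icc a (a + (b - a) / 8)).indicator (fun _ => g (-2 * t)) x
      + (Icc (b - (b - a) / 8) b).indicator (fun _ => g (2 * t)) x := by
  unfold stepFun
  by_cases h1 : x ∈ Icc a (a + (b - a) / 8)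
  · have h2 : x ∉ Icc (b - (b - a) / 8) b := fun h2 => by linarith [h1.2, h2.1]
    simp [h1, h2]
  · by_cases h2 : x ∈ Icc (b - (b - a) / 8) b <;> simp [h1, h2, hg]

theorem integrable_comp_stepFun {a b : ℝ} (hab : a < b) (t : ℝ) {g : ℝ → ℝ} (hg : g 0 = 0) :
    Integrable fun x => g (stepFun a b t x) := by
  simp only [comp_stepFun hab t hg]
  exact ((integrable_indicator_iff measurableSet_Icc).2 (integrableOn_const (by simp))).add
    ((integrable_indicator_iff measurableSet_Icc).2 (integrableOn_const (by simp)))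

theorem setIntegral_comp_stepFun {a b : ℝ} (hab : a < b) (t : ℝ) {g : ℝ → ℝ} (hg : g 0 = 0)
    (c d : ℝ) :
    ∫ x in Ioo c d, g (stepFun a b t x)
      = volume.real (Ioo c d ∩ Icc a (a + (b - a) / 8)) * g (-2 * t)
        + volume.real (Ioo c d ∩ Icc (b - (b - a) / 8) b) * g (2 * t) := by
  have hi : ∀ p q k : ℝ, IntegrableOn ((Icc p q).indicator fun _ => k) (Ioo c d) := fun p q k =>
    (integrableOn_Ioo_const k).indicator measurableSet_Icc
  simp only [comp_stepFun hab t hg]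
  rw [integral_add (hi _ _ _) (hi _ _ _), setIntegral_indicator measurableSet_Icc,
    setIntegral_indicator measurableSet_Icc,
    setIntegral_const, setIntegral_const, smul_eq_mul, smul_eq_mul]

theorem setAverage_comp_stepFun {a b : ℝ} (hab : a < b) (t : ℝ) {g : ℝ → ℝ} (hg : g 0 = 0) :
    ⨍ x in Ioo a b, g (stepFun a b t x) = (g (-2 * t) + g (2 * t)) / 8 := by
  have h1 : Ioo a b ∩ Icc a (a + (b - a) / 8) = Ioc a (a + (b - a) / 8) := by
    ext x
    exact ⟨fun hx => ⟨hx.1.1, hx.2.2⟩,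
      fun hx => ⟨⟨hx.1, by linarith [hx.2]⟩, hx.1.le, hx.2⟩⟩
  have h2 : Ioo a b ∩ Icc (b - (b - a) / 8) b = Ico (b - (b - a) / 8) b := by
    ext x
    exact ⟨fun hx => ⟨hx.2.1, hx.1.2⟩,
      fun hx => ⟨⟨by linarith [hx.1], hx.2⟩, hx.1, hx.2.le⟩⟩
  rw [setAverage_Ioo_eq hab, setIntegral_comp_stepFun hab t hg, h1, h2,
    Real.volume_real_Ioc_of_le (by linarith), Real.volume_real_Ico_of_le (by linarith),
    div_eq_iff (sub_ne_zero.2 hab.ne')]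
  ring

/-- The variance of the step function over an interval is at most `t²`: if the interval misses one
of the two outer pieces, then the values lie at distance `t` from `t` or from `-t`; otherwise it
contains the middle part, and the outer pieces fill at most a quarter of it. -/
theorem integral_sq_stepFun_sub_le {a b : ℝ} (hab : a < b) (t : ℝ) {c d : ℝ} (hcd : c < d) :
    ∫ x in Ioo c d, (stepFun a b t x - ⨍ y in Ioo c d, stepFun a b t y) ^ 2
      ≤ t ^ 2 * (d - c) := by
  have hi : IntegrableOn (stepFun a b t) (Ioo c d) :=
    (integrable_comp_stepFun hab t (g := id) rfl).integrableOn
  have hi2 : IntegrableOn (fun x => stepFun a b t x ^ 2) (Ioo c d) :=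
    (integrable_comp_stepFun hab t (g := fun y => y ^ 2) (by simp)).integrableOn
  suffices H : ∃ k, ∫ x in Ioo c d, (stepFun a b t x - k) ^ 2 ≤ t ^ 2 * (d - c) by
    obtain ⟨k, hk⟩ := H
    exact (integral_sq_sub_setAverage_le hcd hi hi2 k).trans hk
  rcases le_or_gt d (b - (b - a) / 8) with h1 | h1
  · refine ⟨-t, le_of_eq ?_⟩
    rw [← setIntegral_Ioo_const hcd.le]
    refine setIntegral_congr_fun measurableSet_Ioo fun x hx => ?_
    have hx2 : x ∉ Icc (b - (b - a) / 8) b := fun h2 => by linarith [hx.2, h2.1]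
    simp only [stepFun, hx2, if_false]
    split_ifs <;> ring
  rcases le_or_gt (a + (b - a) / 8) c with h2 | h2
  · refine ⟨t, le_of_eq ?_⟩
    rw [← setIntegral_Ioo_const hcd.le]
    refine setIntegral_congr_fun measurableSet_Ioo fun x hx => ?_
    have hx2 : x ∉ Icc a (a + (b - a) / 8) := fun h3 => by linarith [hx.1, h3.2]
    simp only [stepFun, hx2, if_false]
    split_ifs <;> ring
  · refine ⟨0, ?_⟩
    simp only [sub_zero]
    rw [setIntegral_comp_stepFun hab t (g := fun y => y ^ 2) (by simp) c d]
    have hp1 : volume.real (Ioo c d ∩ Icc a (a + (b - a) / 8)) ≤ (b - a) / 8 := by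
      refine (measureReal_mono inter_subset_right (by simp)).trans_eq ?_
      rw [Real.volume_real_Icc_of_le (by linarith)]
      ring
    have hp2 : volume.real (Ioo c d ∩ Icc a (a + (b - a) / 8)) ≤ a + (b - a) / 8 - c := by
      rw [← Real.volume_real_Icc_of_le h2.le]
      exact measureReal_mono (fun x hx => ⟨hx.1.1.le, hx.2.2⟩) (by simp)
    have hq1 : volume.real (Ioo c d ∩ Icc (b - (b - a) / 8) b) ≤ (b - a) / 8 := by
      refine (measureReal_mono inter_subset_right (by simp)).trans_eq ?_
      rw [Real.volume_real_Icc_of_le (by linarith)]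
      ring
    have hq2 : volume.real (Ioo c d ∩ Icc (b - (b - a) / 8) b) ≤ d - (b - (b - a) / 8) := by
      rw [← Real.volume_real_Icc_of_le h1.le]
      exact measureReal_mono (fun x hx => ⟨hx.2.1, hx.1.2.le⟩) (by simp)
    have h3 : 4 * (volume.real (Ioo c d ∩ Icc a (a + (b - a) / 8))
        + volume.real (Ioo c d ∩ Icc (b - (b - a) / 8) b)) ≤ d - c := by linarith
    nlinarith [mul_le_mul_of_nonneg_left h3 (sq_nonneg t)]

/-! ### Bounds for the norm and their sharpness -/

theorem theorem2 (h : ℝ → ℝ) (hh : IsProfile h) :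
    -- the inequality and the norm bounds
    (∀ (Q : Set ℝ) (φ : ℝ → ℝ), Q.OrdConnected → LocallyIntegrableOn φ Q →
      ¬ IsConstantOn Q φ → KSup h Q φ < ∞ →
        MemBMO Q φ ∧ 0 < (bmoNorm Q φ).toReal ∧
        (∀ a b : ℝ, a < b → Ioo a b ⊆ Q →
          IntegrableOn φ (Ioo a b) ∧ IntegrableOn (fun x => φ x ^ 2) (Ioo a b) ∧
          IntegrableOn (fun x => h |φ x - ⨍ y in Ioo a b, φ y|) (Ioo a b) ∧
          ((⨍ x in Ioo a b, φ x ^ 2) - (⨍ x in Ioo a b, φ x) ^ 2)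
              / (4 * (bmoNorm Q φ).toReal ^ 2) * h (2 * (bmoNorm Q φ).toReal)
            ≤ ⨍ x in Ioo a b, h |φ x - ⨍ y in Ioo a b, φ y|) ∧
        halfLineInv h (KSup h Q φ).toReal ≤ (bmoNorm Q φ).toReal ∧
        (bmoNorm Q φ).toReal ≤ 1 / 2 * halfLineInv h (4 * (KSup h Q φ).toReal)) ∧
    -- sharpness: equality on any prescribed subinterval, for any prescribed value of the norm
    (∀ (Q : Set ℝ) (a b t : ℝ), Q.OrdConnected → a < b → Ioo a b ⊆ Q → 0 < t →
      LocallyIntegrableOn (stepFun a b t) Q ∧ ¬ IsConstantOn Q (stepFun a b t) ∧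
      KSup h Q (stepFun a b t) < ∞ ∧
      bmoNorm Q (stepFun a b t) = ENNReal.ofReal t ∧
      ((⨍ x in Ioo a b, stepFun a b t x ^ 2) - (⨍ x in Ioo a b, stepFun a b t x) ^ 2)
          / (4 * (bmoNorm Q (stepFun a b t)).toReal ^ 2)
          * h (2 * (bmoNorm Q (stepFun a b t)).toReal)
        = ⨍ x in Ioo a b, h |stepFun a b t x - ⨍ y in Ioo a b, stepFun a b t y|) := by
  constructor
  · intro Q φ hQ hloc hconst hK
    have hm := hloc.aestronglyMeasurable
    obtain ⟨A, hA, hφ⟩ := exists_bound_of_KSup_lt_top hh hm hK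
    have hi2 : ∀ a b : ℝ, a < b → Ioo a b ⊆ Q →
        IntegrableOn (fun x => (φ x - ⨍ y in Ioo a b, φ y) ^ 2) (Ioo a b) := fun a b hab hsub =>
      integrableOn_sq_sub_const (hφ a b hab hsub).1 (hφ a b hab hsub).2.1 _
    have hfin : bmoNorm Q φ < ∞ := by
      refine (bmoNorm_le (Real.sqrt_nonneg (90 * A ^ 2)) fun a b hab hsub =>
        ⟨hi2 a b hab hsub, ?_⟩).trans_lt ENNReal.ofReal_lt_top
      rw [Real.sq_sqrt (by positivity)]
      exact (hφ a b hab hsub).2.2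
    have hosc : ∀ a b : ℝ, a < b → Ioo a b ⊆ Q → ∫ x in Ioo a b, (φ x - ⨍ y in Ioo a b, φ y) ^ 2
        ≤ (bmoNorm Q φ).toReal ^ 2 * (b - a) := fun a b hab hsub =>
      integral_sq_le_bmoNorm hfin hab hsub (hi2 a b hab hsub)
    have hKint := fun a b (hab : a < b) hsub => integral_le_KSup hh hm hK hab hsub
    set ε := (bmoNorm Q φ).toReal with hεdef
    have hε : 0 < ε := by
      refine ENNReal.toReal_nonneg.lt_of_ne fun h0 => hconst ?_
      refine isConstantOn_of_integral_sq_nonpos hQ fun a b hab hsub => ⟨hi2 a b hab hsub, ?_⟩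
      have := hosc a b hab hsub
      rwa [hεdef, ← h0, zero_pow two_ne_zero, zero_mul] at this
    have hmain : ∀ a b : ℝ, a < b → Ioo a b ⊆ Q →
        (∫ x in Ioo a b, (φ x - ⨍ y in Ioo a b, φ y) ^ 2) / (4 * ε ^ 2) * h (2 * ε)
          ≤ ∫ x in Ioo a b, h |φ x - ⨍ y in Ioo a b, φ y| := fun a b hab hsub =>
      hh.mul_integral_sq_le hab hε (hφ a b hab hsub).1 (hφ a b hab hsub).2.1
        fun c d hac hcd hdb => hosc c d hcd ((Ioo_subset_Ioo hac hdb).trans hsub)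
    have h2ε : 0 < h (2 * ε) := hh.pos (by positivity)
    set K := (KSup h Q φ).toReal with hKdef
    have hK0 : 0 ≤ K := ENNReal.toReal_nonneg
    refine ⟨⟨hloc, hfin⟩, hε, fun a b hab hsub => ⟨(hφ a b hab hsub).1, (hφ a b hab hsub).2.1,
      (hKint a b hab hsub).1, ?_⟩, ?_, ?_⟩
    · rw [setAverage_sq_sub_sq hab (hφ a b hab hsub).1 (hφ a b hab hsub).2.1,
        setAverage_Ioo_eq hab (fun x => h |φ x - ⨍ y in Ioo a b, φ y|),
        le_div_iff₀ (sub_pos.2 hab)]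
      refine le_of_eq_of_le ?_ (hmain a b hab hsub)
      have := sub_pos.2 hab
      field_simp
    · refine hh.halfLineInv_le hK0 hε.le (ENNReal.toReal_le_of_le_ofReal (hh.nonneg hε.le)
        (KSup_le hh fun a b hab hsub => ⟨(hKint a b hab hsub).1, ?_⟩))
      exact hh.integral_comp_abs_le hab hε.le
        ((hφ a b hab hsub).1.sub (integrableOn_Ioo_const _)) (hi2 a b hab hsub) (hosc a b hab hsub)
    · have hle : ε ≤ √(4 * ε ^ 2 / h (2 * ε) * K) := by
        refine ENNReal.toReal_le_of_le_ofReal (Real.sqrt_nonneg _)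
          (bmoNorm_le (Real.sqrt_nonneg _) fun a b hab hsub => ⟨hi2 a b hab hsub, ?_⟩)
        rw [Real.sq_sqrt (by positivity)]
        have h1 := (hmain a b hab hsub).trans (hKint a b hab hsub).2
        rw [div_mul_eq_mul_div, div_le_iff₀ (by positivity), ← le_div_iff₀ h2ε] at h1
        refine h1.trans_eq ?_
        ring
      rw [Real.le_sqrt' hε, div_mul_eq_mul_div, le_div_iff₀ h2ε] at hle
      have h4 : h (2 * ε) ≤ 4 * K := by
        refine le_of_mul_le_mul_left ?_ (pow_pos hε 2)
        linarith
      linarith [hh.le_halfLineInv (by positivity) (by positivity) h4]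
  · intro Q a b t _ hab hsub ht
    have hi : ∀ c d : ℝ, IntegrableOn (stepFun a b t) (Ioo c d) := fun c d =>
      (integrable_comp_stepFun hab t (g := id) rfl).integrableOn
    have hi2 : ∀ c d k : ℝ, IntegrableOn (fun x => (stepFun a b t x - k) ^ 2) (Ioo c d) :=
      fun c d k => integrableOn_sq_sub_const (hi c d)
        (integrable_comp_stepFun hab t (g := fun y => y ^ 2) (by simp)).integrableOn k
    have hmean : ⨍ x in Ioo a b, stepFun a b t x = 0 :=
      (setAverage_comp_stepFun hab t (g := id) rfl).trans (by simp)
    have hsq : ⨍ x in Ioo a b, stepFun a b t x ^ 2 = t ^ 2 :=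
      (setAverage_comp_stepFun hab t (g := fun y => y ^ 2) (by simp)).trans (by ring)
    have hle : bmoNorm Q (stepFun a b t) ≤ ENNReal.ofReal t :=
      bmoNorm_le ht.le fun c d hcd _ => ⟨hi2 c d _, integral_sq_stepFun_sub_le hab t hcd⟩
    have hnorm : bmoNorm Q (stepFun a b t) = ENNReal.ofReal t := by
      have hfin := hle.trans_lt ENNReal.ofReal_lt_top
      refine hle.antisymm (ENNReal.ofReal_le_of_le_toReal ?_)
      have h1 := integral_sq_le_bmoNorm hfin hab hsub (hi2 a b _)
      simp only [hmean, sub_zero] at h1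
      rw [← mul_setAverage_Ioo hab, hsq, mul_comm] at h1
      exact le_of_sq_le_sq (le_of_mul_le_mul_right h1 (sub_pos.2 hab)) ENNReal.toReal_nonneg
    refine ⟨(integrable_comp_stepFun hab t (g := id) rfl).locallyIntegrable.locallyIntegrableOn Q,
      ?_, ?_, hnorm, ?_⟩
    · rintro ⟨c, hc⟩
      have hc' := ae_restrict_of_ae_restrict_of_subset hsub hc
      have h1 : ⨍ x in Ioo a b, stepFun a b t x = c := by
        rw [setAverage_Ioo_eq hab, integral_congr_ae hc', setIntegral_Ioo_const hab.le,
          mul_div_cancel_right₀ _ (sub_ne_zero.2 hab.ne')]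
      have h2 : ⨍ x in Ioo a b, stepFun a b t x ^ 2 = c ^ 2 := by
        rw [setAverage_Ioo_eq hab, integral_congr_ae (g := fun _ => c ^ 2)
          (hc'.mono fun x hx => by simp only [hx]), setIntegral_Ioo_const hab.le,
          mul_div_cancel_right₀ _ (sub_ne_zero.2 hab.ne')]
      rw [hmean] at h1
      rw [hsq, ← h1] at h2
      exact ht.ne' (pow_eq_zero_iff two_ne_zero |>.1 (h2.trans (by simp)))
    · refine (KSup_le (κ := h t) hh fun c d hcd _ => ?_).trans_lt ENNReal.ofReal_lt_top
      have hs : IntegrableOn (fun x => stepFun a b t x - ⨍ y in Ioo c d, stepFun a b t y)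
          (Ioo c d) := (hi c d).sub (integrableOn_Ioo_const _)
      exact ⟨hh.integrableOn_comp_abs hs, hh.integral_comp_abs_le hcd ht.le hs (hi2 c d _)
        (integral_sq_stepFun_sub_le hab t hcd)⟩
    · rw [hnorm, ENNReal.toReal_ofReal ht.le, hsq, hmean]
      simp only [sub_zero]
      rw [setAverage_comp_stepFun hab t (g := fun y => h |y|) (by simp [hh.map_zero])]
      have h1 : |-2 * t| = 2 * t := by rw [neg_mul, abs_neg, abs_of_pos (by positivity)]
      rw [h1, abs_of_pos (by positivity : 0 < 2 * t)]
      field_simp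
      ring
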